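/- Let $n\ge 2$, $N=2^n$, and identify $i\in\{0,\dots,N-1\}$ with $z=(z_1,\dots,z_n)\in\mathbb F_2^n$ by $i=\sum_k z_k2^{k-1}$. Let $T_N=\left(\begin{smallmatrix}1&0\\1&1\end{smallmatrix}\right)^{\otimes n}$ and let $\mathcal C=\{uT_N: u\in\mathbb F_2^N,\ u_i=0 \text{ for } i\notin\mathcal I\}$ be the polar code with information set $\mathcal I$. Row $i$ of $T_N$ is the evaluation $z\mapsto\prod_{k:\,i_k=0}(1+z_k)$ of a monomial, where $i_k$ is the $k$-th bit of $i$. Assume that $\mathcal C$ is a decreasing monomial code: the set of monomials given by the rows in $\mathcal I$ contains all factors and all antecedents of its members, where $x_{a_1}\cdots x_{a_d}$ ($a_1<\dots<a_d$) is an antecedent of $x_{b_1}\cdots x_{b_d}$ ($b_1<\dots<b_d$) if $a_l\le b_l$ for all $l$. For $S=(s_1,\dots,s_t)$ with $s_j\ge1$ and $\sum_j s_j=n$, let $\mathsf{BLTA}(S)$ be the group of maps $z\mapsto Az+b$ of $\mathbb F_2^n$ with $A$ invertible and block lower triangular with diagonal blocks of sizes $s_1,\dots,s_t$. A permutation $\pi$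 of $\mathbb F_2^n$ acts on vectors by $(\pi y)_z=y_{\pi(z)}$; the affine automorphism group $\mathcal A$ of $\mathcal C$ consists of the invertible affine maps that map every codeword to a codeword. Let $\mathrm{SC}$ be the min-sum successive-cancellation decoder of $\mathcal C$ with real input $y\in\mathbb R^N$. For $N=1$ it returns $0$ if the bit is frozen, and otherwise $1$ if $y<0$ and $0$ if $y\ge0$. For $N>1$ split $y=(y',y'')$ into halves, decode the first half of the input bits from the values $\operatorname{sgn}(y'_j)\operatorname{sgn}(y''_j)\min(|y'_j|,|y''_j|)$, obtaining a word $x'$, decode the second half from the values $y''_j+(-1)^{x'_j}y'_j$, obtaining $x''$, and return $(x'+x'',x'')$. Say that $y$ is tie-free if, in decoding $y$, the value on which each information bit is decided is nonzero. For $\pi\in\mathcal A$ put $\mathrm{aSC}(y,\pi)=\pi^{-1}(\mathrm{SC}(\pi y))$, call $\pi_1,\pi_2\in\mathcal A$ equivalent if $\mathrm{aSC}(y,\pi_1)=\mathrm{aSC}(y,\pi_2)$ for Lebesgue-almost every $y\in\mathbb R^N$, and let $[\mathbb 1]\le\mathcal A$ be the class of the identity. If $\mathcal A=\mathsf{BLTA}(S)$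 with first block size $s_1>1$, then $\mathsf{BLTA}(2,1,\dots,1)\le[\mathbb 1]$. Moreover, $\mathrm{aSC}(y,\pi)=\mathrm{SC}(y)$ for every $\pi\in\mathsf{BLTA}(2,1,\dots,1)$ and every tie-free $y\in\mathbb R^N$. -/

import Mathlib

open MeasureTheory

noncomputable section

namespace PolarSC

/-! ### Indices, words and permutations -/

/-- Binary representations of the indices `0, …, 2 ^ n - 1`: the point `z` stands for the index
`∑ k, z k * 2 ^ k`, so the coordinate `0` is the least significant bit and the last coordinate is
the most significant bit. -/
abbrev Idx (n : ℕ) : Type := Fin n → ZMod 2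

/-- Binary words of length `2 ^ n`. -/
abbrev Word (n : ℕ) : Type := Idx n → ZMod 2

/-- Received signals (real vectors of length `2 ^ n`). -/
abbrev Signal (n : ℕ) : Type := Idx n → ℝ

/-- The action of a permutation of the positions on a vector: `(π y) z = y (π z)`. -/
def permute {n : ℕ} {α : Type} (π : Equiv.Perm (Idx n)) (y : Idx n → α) : Idx n → α :=
  fun z => y (π z)

/-! ### Polar codes -/

/-- The kernel `T₂ = [1 0; 1 1]`. -/
def kernel (a b : ZMod 2) : ZMod 2 := if a = 0 ∧ b = 1 then 0 else 1

/-- The transformation matrix `T_N`, `N = 2 ^ n`: the `n`-fold Kronecker power of the kernel. -/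
def transform (n : ℕ) : Matrix (Idx n) (Idx n) (ZMod 2) :=
  fun i j => ∏ k, kernel (i k) (j k)

/-- The polar code with information set `I`: all `u * T_N` with `u i = 0` at the frozen
positions `i ∉ I`, that is, the span of the rows of `T_N` with index in `I`. -/
def polarCode {n : ℕ} (I : Set (Idx n)) : Submodule (ZMod 2) (Word n) :=
  Submodule.span (ZMod 2) (transform n '' I)

/-- The set of variables of the monomial whose evaluation is the row `i` of `T_N`.
That row is `z ↦ ∏ (1 + z k)` over the positions `k` with `i k = 0`. -/
def rowMonomial {n : ℕ} (i : Idx n) : Finset (Fin n) := Finset.univ.filter fun k => i k = 0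

/-- The generating monomial set of the polar code with information set `I`; a (squarefree)
monomial is given by its set of variables. -/
def generatingMonomials {n : ℕ} (I : Set (Idx n)) : Set (Finset (Fin n)) := rowMonomial '' I

/-- `M` is an antecedent of `M'`: both have the same degree, and the `l`-th variable of `M` has an
index at most that of the `l`-th variable of `M'`, for every `l` (variables listed in increasing
order). -/
def IsAntecedent {n : ℕ} (M M' : Finset (Fin n)) : Prop :=
  ∃ h : M.card = M'.card, ∀ l : Fin M'.card, M.orderEmbOfFin h l ≤ M'.orderEmbOfFin rfl l

/-- A monomial set is decreasing if it contains all factors and all antecedents of each of its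
members. -/
def IsDecreasing {n : ℕ} (G : Set (Finset (Fin n))) : Prop :=
  (∀ M ∈ G, ∀ M' : Finset (Fin n), M' ⊆ M → M' ∈ G) ∧
    ∀ M ∈ G, ∀ M' : Finset (Fin n), IsAntecedent M' M → M' ∈ G

/-! ### Affine automorphisms -/

/-- A set of permutations that contains `1` and is closed under products is a group. -/
def subgroupOfMulClosed {n : ℕ} (s : Set (Equiv.Perm (Idx n))) (h1 : 1 ∈ s)
    (hm : ∀ a ∈ s, ∀ b ∈ s, a * b ∈ s) : Subgroup (Equiv.Perm (Idx n)) where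
  carrier := s
  one_mem' := h1
  mul_mem' := fun ha hb => hm _ ha _ hb
  inv_mem' := by
    intro a ha
    have hp : ∀ k : ℕ, a ^ k ∈ s := by
      intro k
      induction k with
      | zero => simpa using h1
      | succ k ih => rw [pow_succ]; exact hm _ ih _ ha
    have hk : a⁻¹ = a ^ (orderOf a - 1) := by
      rw [inv_eq_iff_mul_eq_one, ← pow_succ',
        Nat.sub_add_cancel (orderOf_pos a), pow_orderOf_eq_one]
    show a⁻¹ ∈ s
    rw [hk]
    exact hp _

/-- `π` is the affine transformation `z ↦ A z + b`. -/
def IsAffineMap {n : ℕ} (π : Equiv.Perm (Idx n)) (A : Matrix (Fin n) (Fin n) (ZMod 2))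
    (b : Idx n) : Prop :=
  ∀ z, π z = A.mulVec z + b

theorem IsAffineMap.one {n : ℕ} : IsAffineMap (1 : Equiv.Perm (Idx n)) 1 0 := by
  intro z; simp

theorem IsAffineMap.mul {n : ℕ} {π σ : Equiv.Perm (Idx n)}
    {A B : Matrix (Fin n) (Fin n) (ZMod 2)} {a b : Idx n}
    (hπ : IsAffineMap π A a) (hσ : IsAffineMap σ B b) :
    IsAffineMap (π * σ) (A * B) (A.mulVec b + a) := by
  intro z
  rw [Equiv.Perm.mul_apply, hσ z, hπ, Matrix.mulVec_add, Matrix.mulVec_mulVec, add_assoc]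

/-- The group `BLTA(S)` of the affine transformations `z ↦ A z + b` with `A` invertible and block
lower triangular, the diagonal blocks having the sizes `S = (s₁, …, s_t)`: the entry `A i j`
vanishes whenever the block of `i` comes before the block of `j`. -/
def BLTA {n : ℕ} (S : Composition n) : Subgroup (Equiv.Perm (Idx n)) :=
  subgroupOfMulClosed
    {π | ∃ (A : Matrix (Fin n) (Fin n) (ZMod 2)) (b : Idx n), IsUnit A ∧
      (∀ i j, S.index i < S.index j → A i j = 0) ∧ IsAffineMap π A b}
    ⟨1, 0, isUnit_one,
      fun i j h => Matrix.one_apply_ne (fun e => absurd h (by rw [e]; exact lt_irrefl _)),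
      IsAffineMap.one⟩
    (by
      rintro π ⟨A, a, hA, hA0, hπ⟩ σ ⟨B, b, hB, hB0, hσ⟩
      refine ⟨A * B, _, hA.mul hB, ?_, hπ.mul hσ⟩
      intro i j hij
      rw [Matrix.mul_apply]
      refine Finset.sum_eq_zero fun k _ => ?_
      rcases lt_or_ge (S.index i) (S.index k) with h | h
      · rw [hA0 i k h, zero_mul]
      · rw [hB0 k j (lt_of_le_of_lt h hij), mul_zero])

/-- The block structure `(2, 1, …, 1)` of `n ≥ 2`. -/
def twoOnes (n : ℕ) (hn : 2 ≤ n) : Composition n where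
  blocks := 2 :: List.replicate (n - 2) 1
  blocks_pos := by
    intro i hi
    rcases List.mem_cons.1 hi with h | h
    · omega
    · rw [List.eq_of_mem_replicate h]; exact Nat.one_pos
  blocks_sum := by
    rw [List.sum_cons, List.sum_replicate, smul_eq_mul, mul_one]; omega

/-- The affine automorphism group of the polar code with information set `I`: the permutations of
the positions that are invertible affine transformations of the binary representations and map
every codeword to a codeword. -/
def affineAut {n : ℕ} (I : Set (Idx n)) : Subgroup (Equiv.Perm (Idx n)) :=
  subgroupOfMulClosed
    {π | (∃ (A : Matrix (Fin n) (Fin n) (ZMod 2)) (b : Idx n), IsUnit A ∧ IsAffineMap π A b) ∧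
      ∀ x ∈ polarCode I, permute π x ∈ polarCode I}
    ⟨⟨1, 0, isUnit_one, IsAffineMap.one⟩, fun _ hx => hx⟩
    (by
      rintro π ⟨⟨A, a, hA, hπ⟩, hπC⟩ σ ⟨⟨B, b, hB, hσ⟩, hσC⟩
      exact ⟨⟨A * B, _, hA.mul hB, hπ.mul hσ⟩, fun x hx => hσC _ (hπC x hx)⟩)

/-! ### Automorphism decoders and decoder equivalence -/

/-- A decoder maps a received signal to an estimated word. -/
abbrev Decoder (n : ℕ) : Type := Signal n → Word n

/-- The automorphism decoder `adec (y, π) = π⁻¹ (dec (π y))`. -/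
def autDec {n : ℕ} (dec : Decoder n) (y : Signal n) (π : Equiv.Perm (Idx n)) : Word n :=
  permute π⁻¹ (dec (permute π y))

/-- Decoder equivalence: both automorphism decoders have the same output, for almost every
received signal with respect to Lebesgue measure. (A null set has to be excepted: the output of a
hard-decision decoder at a tie depends on an arbitrary tie-breaking rule.) -/
def DecEquiv {n : ℕ} (dec : Decoder n) (π₁ π₂ : Equiv.Perm (Idx n)) : Prop :=
  ∀ᵐ y : Signal n, autDec dec y π₁ = autDec dec y π₂

/-- The equivalence class `[π]` in the group `A` with respect to the decoder `dec`. -/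
def eqClass {n : ℕ} (A : Subgroup (Equiv.Perm (Idx n))) (dec : Decoder n)
    (π : Equiv.Perm (Idx n)) : Set (Equiv.Perm (Idx n)) :=
  {π' | π' ∈ A ∧ DecEquiv dec π π'}

theorem permute_measurePreserving {n : ℕ} (π : Equiv.Perm (Idx n)) :
    MeasurePreserving (fun y : Signal n => permute π y) volume volume := by
  have h := volume_measurePreserving_piCongrLeft (fun _ : Idx n => ℝ) π.symm
  have e : (MeasurableEquiv.piCongrLeft (fun _ : Idx n => ℝ) π.symm : Signal n → Signal n)
      = fun y => permute π y := by
    funext y z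
    obtain ⟨w, rfl⟩ := π.symm.surjective z
    rw [MeasurableEquiv.coe_piCongrLeft, Equiv.piCongrLeft_apply_apply]
    simp [permute]
  rwa [e] at h

theorem eqClass_one_mul_mem {n : ℕ} (A : Subgroup (Equiv.Perm (Idx n))) (dec : Decoder n) :
    ∀ π ∈ eqClass A dec 1, ∀ σ ∈ eqClass A dec 1, π * σ ∈ eqClass A dec 1 := by
  rintro π ⟨hπA, hπ⟩ σ ⟨hσA, hσ⟩
  refine ⟨A.mul_mem hπA hσA, ?_⟩
  have hσ' := (permute_measurePreserving π).quasiMeasurePreserving.ae hσ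
  unfold DecEquiv at hπ
  filter_upwards [hπ, hσ'] with y h1 h2
  have h3 : dec (permute π y) = permute σ⁻¹ (dec (permute σ (permute π y))) := h2
  rw [h1]
  show permute π⁻¹ (dec (permute π y)) = permute (π * σ)⁻¹ (dec (permute (π * σ) y))
  rw [h3]
  funext z
  simp [permute, mul_inv_rev]
  rfl

/-- The group `[𝟙]` of the automorphisms in `A` that are absorbed by the decoder `dec`; its
carrier is the equivalence class of the identity. -/
def absorbed {n : ℕ} (A : Subgroup (Equiv.Perm (Idx n))) (dec : Decoder n) :
    Subgroup (Equiv.Perm (Idx n)) :=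
  subgroupOfMulClosed (eqClass A dec 1)
    ⟨A.one_mem, Filter.Eventually.of_forall fun _ => rfl⟩ (eqClass_one_mul_mem A dec)

/-! ### Successive-cancellation decoding -/

/-- The check-node update of log-likelihood ratios (min-sum form). -/
def checkNode (a b : ℝ) : ℝ := Real.sign a * Real.sign b * min |a| |b|

/-- The variable-node update of log-likelihood ratios, given the decided bit `u`. -/
def varNode (u : ZMod 2) (a b : ℝ) : ℝ := if u = 0 then b + a else b - a

/-- The half of an index set with most significant bit `c`. -/
def half {n : ℕ} (c : ZMod 2) (I : Set (Idx (n + 1))) : Set (Idx n) :=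
  {z | (Fin.snoc z c : Idx (n + 1)) ∈ I}

/-- The log-likelihood ratios passed to the decoder of the first half of the input bits. -/
def leftLLR {n : ℕ} (y : Signal (n + 1)) : Signal n :=
  fun z => checkNode (y (Fin.snoc z 0)) (y (Fin.snoc z 1))

/-- The log-likelihood ratios passed to the decoder of the second half of the input bits, given
the decision `x` of the decoder of the first half. -/
def rightLLR {n : ℕ} (x : Word n) (y : Signal (n + 1)) : Signal n :=
  fun z => varNode (x z) (y (Fin.snoc z 0)) (y (Fin.snoc z 1))

open scoped Classical in
/-- Successive-cancellation decoding of the polar code with information set `I`; the output is the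
estimated codeword `û * T_N`. The input bits are decided in the natural order of their indices; a
frozen bit is set to `0`, and an information bit to the hard decision on its log-likelihood ratio
(`1` if this is negative, `0` otherwise). -/
def sc : (n : ℕ) → Set (Idx n) → Signal n → Word n
  | 0, I, y => fun z => if z ∈ I ∧ y z < 0 then 1 else 0
  | n + 1, I, y =>
    let xl : Word n := sc n (half 0 I) (leftLLR y)
    let xr : Word n := sc n (half 1 I) (rightLLR xl y)
    fun z => if z (Fin.last n) = 0 then xl (Fin.init z) + xr (Fin.init z) else xr (Fin.init z)

/-- Successive-cancellation decoding of `y` meets no tie: the log-likelihood ratio on which each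
information bit is decided is nonzero. -/
def TieFree : (n : ℕ) → Set (Idx n) → Signal n → Prop
  | 0, I, y => ∀ z, z ∈ I → y z ≠ 0
  | n + 1, I, y =>
    TieFree n (half 0 I) (leftLLR y) ∧
      TieFree n (half 1 I) (rightLLR (sc n (half 0 I) (leftLLR y)) y)

end PolarSC

end

/-! The proof is an induction on `n` that removes the most significant bit. For a lower triangular
last column, the map is `(w, c) ↦ (σ w, c + f w)` with `f` affine and `σ` of the same kind on `n -
1` bits. The check node is symmetric, so the left decoder sees its input permuted by `σ` and, by
induction, returns the permuted word `x`. Where `f w = 1` the two observations trade places: the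
variable node is unchanged if the decided bit is `0` and changes sign if it is `1`. So the right
decoder sees its input permuted by `σ` and sign-flipped along the word `(f ∘ σ⁻¹) · x`.

Two facts absorb this flip. Multiplying a left codeword by an affine function gives a right
codeword, because the code is decreasing (`IsStable.affine_mul_mem`). Away from ties, decoding
commutes with sign changes by codewords (`sc_flip`).

The induction starts at length four, where the `2 × 2` block acts. Since `s₁ > 1`, the information
set is invariant under exchanging the two lowest bits, which leaves only the zero, repetition,
parity-check and full codes. Min-sum SC is maximum-likelihood on these (`IsStable.isML`), and they
are invariant under every permutation, so decoding commutes with it (`IsML.sc_permute`).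

Ties lie in a finite union of proper subspaces (`exists_tieFree_functionals`), which gives the
almost-everywhere statement. -/

noncomputable section

namespace PolarSC

/-! ### The recursive structure of polar codes -/

/-- The input word of the first half of a codeword of length `2 ^ (n + 1)`, re-encoded. -/
def leftWord {n : ℕ} : Word (n + 1) →ₗ[ZMod 2] Word n where
  toFun c z := c (Fin.snoc z 0) + c (Fin.snoc z 1)
  map_add' c d := by funext z; simp only [Pi.add_apply]; ring
  map_smul' a c := by funext z; simp [mul_add]

/-- The second half of a codeword of length `2 ^ (n + 1)`. -/
def rightWord {n : ℕ} : Word (n + 1) →ₗ[ZMod 2] Word n where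
  toFun c z := c (Fin.snoc z 1)
  map_add' _ _ := rfl
  map_smul' _ _ := rfl

/-- The word `(x, 0)`. -/
def embedLeft {n : ℕ} : Word n →ₗ[ZMod 2] Word (n + 1) where
  toFun x z := if z (Fin.last n) = 0 then x (Fin.init z) else 0
  map_add' c d := by funext z; by_cases h : z (Fin.last n) = 0 <;> simp [h]
  map_smul' a c := by funext z; by_cases h : z (Fin.last n) = 0 <;> simp [h]

/-- The word `(x, x)`. -/
def embedRight {n : ℕ} : Word n →ₗ[ZMod 2] Word (n + 1) where
  toFun x z := x (Fin.init z)
  map_add' _ _ := rfl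
  map_smul' _ _ := rfl

theorem leftWord_apply {n : ℕ} (c : Word (n + 1)) (z : Idx n) :
    leftWord c z = c (Fin.snoc z 0) + c (Fin.snoc z 1) := rfl

theorem rightWord_apply {n : ℕ} (c : Word (n + 1)) (z : Idx n) :
    rightWord c z = c (Fin.snoc z 1) := rfl

theorem zmod_two_cases (b : ZMod 2) : b = 0 ∨ b = 1 := by
  revert b; decide

theorem zmod_two_add_self (b : ZMod 2) : b + b = 0 := by
  revert b; decide

theorem embed_leftWord_rightWord {n : ℕ} (c : Word (n + 1)) :
    embedLeft (leftWord c) + embedRight (rightWord c) = c := by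
  funext z
  have hz : (Fin.snoc (Fin.init z) (z (Fin.last n)) : Idx (n + 1)) = z := Fin.snoc_init_self z
  rcases zmod_two_cases (z (Fin.last n)) with h | h
  · rw [h] at hz
    simp [embedLeft, embedRight, leftWord, rightWord, h, hz, add_assoc, zmod_two_add_self]
  · rw [h] at hz
    simp [embedLeft, embedRight, rightWord, h, hz]

theorem word_ext {n : ℕ} {c d : Word (n + 1)} (hl : leftWord c = leftWord d)
    (hr : rightWord c = rightWord d) : c = d := by
  rw [← embed_leftWord_rightWord c, hl, hr, embed_leftWord_rightWord]

theorem transform_snoc {n : ℕ} (i z : Idx n) (a b : ZMod 2) :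
    transform (n + 1) (Fin.snoc i a) (Fin.snoc z b) = transform n i z * kernel a b := by
  simp [transform, Fin.prod_univ_castSucc]

theorem leftWord_transform_zero {n : ℕ} (i : Idx n) :
    leftWord (transform (n + 1) (Fin.snoc i 0)) = transform n i := by
  funext z; simp [leftWord_apply, transform_snoc, kernel]

theorem leftWord_transform_one {n : ℕ} (i : Idx n) :
    leftWord (transform (n + 1) (Fin.snoc i 1)) = 0 := by
  funext z; simp [leftWord_apply, transform_snoc, kernel, zmod_two_add_self]

theorem rightWord_transform_zero {n : ℕ} (i : Idx n) :
    rightWord (transform (n + 1) (Fin.snoc i 0)) = 0 := by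
  funext z; simp [rightWord_apply, transform_snoc, kernel]

theorem rightWord_transform_one {n : ℕ} (i : Idx n) :
    rightWord (transform (n + 1) (Fin.snoc i 1)) = transform n i := by
  funext z; simp [rightWord_apply, transform_snoc, kernel]

theorem transform_mem_polarCode {n : ℕ} {I : Set (Idx n)} {i : Idx n} (hi : i ∈ I) :
    (transform n i : Word n) ∈ polarCode I :=
  Submodule.subset_span ⟨i, hi, rfl⟩

theorem embedLeft_transform {n : ℕ} (i : Idx n) :
    embedLeft (transform n i) = transform (n + 1) (Fin.snoc i 0) := by
  rw [← embed_leftWord_rightWord (transform (n + 1) (Fin.snoc i 0)), leftWord_transform_zero,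
    rightWord_transform_zero, map_zero, add_zero]

theorem embedRight_transform {n : ℕ} (i : Idx n) :
    embedRight (transform n i) = transform (n + 1) (Fin.snoc i 1) := by
  rw [← embed_leftWord_rightWord (transform (n + 1) (Fin.snoc i 1)), leftWord_transform_one,
    rightWord_transform_one, map_zero, zero_add]

/-- Plotkin decomposition: rows with top bit `0` have the form `(x, 0)`, rows with top bit `1` the
form `(x, x)`. -/
theorem mem_polarCode_succ {n : ℕ} {I : Set (Idx (n + 1))} {c : Word (n + 1)} :
    c ∈ polarCode I ↔
      leftWord c ∈ polarCode (half 0 I) ∧ rightWord c ∈ polarCode (half 1 I) := by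
  constructor
  · intro hc
    have h : polarCode I ≤ (polarCode (half 0 I)).comap leftWord ⊓
        (polarCode (half 1 I)).comap rightWord := by
      refine Submodule.span_le.2 ?_
      rintro _ ⟨i, hi, rfl⟩
      have hz : (Fin.snoc (Fin.init i) (i (Fin.last n)) : Idx (n + 1)) = i :=
        Fin.snoc_init_self i
      rw [← hz] at hi ⊢
      rcases zmod_two_cases (i (Fin.last n)) with h | h
      · rw [h] at hi ⊢
        refine ⟨?_, ?_⟩
        · change leftWord _ ∈ polarCode (half 0 I)
          rw [leftWord_transform_zero]; exact transform_mem_polarCode hi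
        · change rightWord _ ∈ polarCode (half 1 I)
          rw [rightWord_transform_zero]; exact zero_mem _
      · rw [h] at hi ⊢
        refine ⟨?_, ?_⟩
        · change leftWord _ ∈ polarCode (half 0 I)
          rw [leftWord_transform_one]; exact zero_mem _
        · change rightWord _ ∈ polarCode (half 1 I)
          rw [rightWord_transform_one]; exact transform_mem_polarCode hi
    exact h hc
  · rintro ⟨hl, hr⟩
    have h0 : polarCode (half 0 I) ≤ (polarCode I).comap embedLeft := by
      refine Submodule.span_le.2 ?_
      rintro _ ⟨i, hi, rfl⟩
      change embedLeft (transform n i) ∈ polarCode I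
      rw [embedLeft_transform]
      exact transform_mem_polarCode hi
    have h1 : polarCode (half 1 I) ≤ (polarCode I).comap embedRight := by
      refine Submodule.span_le.2 ?_
      rintro _ ⟨i, hi, rfl⟩
      change embedRight (transform n i) ∈ polarCode I
      rw [embedRight_transform]
      exact transform_mem_polarCode hi
    rw [← embed_leftWord_rightWord c]
    exact add_mem (h0 hl) (h1 hr)

theorem polarCode_empty {n : ℕ} : polarCode (∅ : Set (Idx n)) = ⊥ := by
  refine Submodule.span_eq_bot.2 ?_
  rintro _ ⟨i, hi, -⟩
  exact hi.elim

theorem half_univ {n : ℕ} (b : ZMod 2) : half b (Set.univ : Set (Idx (n + 1))) = Set.univ := rfl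

theorem half_empty {n : ℕ} (b : ZMod 2) : half b (∅ : Set (Idx (n + 1))) = ∅ := rfl

theorem polarCode_zero_of_mem {I : Set (Idx 0)} {i : Idx 0} (hi : i ∈ I) (c : Word 0) :
    c ∈ polarCode I := by
  have h : c = c i • (transform 0 i : Word 0) := by
    funext z
    rw [Subsingleton.elim z i]
    simp [transform]
  rw [h]
  exact Submodule.smul_mem _ _ (transform_mem_polarCode hi)

theorem polarCode_univ {n : ℕ} : polarCode (Set.univ : Set (Idx n)) = ⊤ := by
  induction n with
  | zero => exact eq_top_iff.2 fun c _ => polarCode_zero_of_mem (Set.mem_univ 0) c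
  | succ n ih =>
    refine eq_top_iff.2 fun c _ => mem_polarCode_succ.2 ?_
    rw [half_univ, half_univ, ih]
    exact ⟨trivial, trivial⟩

/-- Carries invariance of the code back to the information set; it amounts to the independence of
the rows of `T_N`. -/
theorem mem_of_transform_mem_polarCode {n : ℕ} {I : Set (Idx n)} {i : Idx n}
    (h : (transform n i : Word n) ∈ polarCode I) : i ∈ I := by
  induction n with
  | zero =>
    by_contra hi
    have hI : I = ∅ := Set.eq_empty_of_forall_notMem fun j hj => hi (Subsingleton.elim j i ▸ hj)
    rw [hI, polarCode_empty, Submodule.mem_bot] at h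
    have := congrFun h i
    simp [transform] at this
  | succ n ih =>
    have hz : (Fin.snoc (Fin.init i) (i (Fin.last n)) : Idx (n + 1)) = i := Fin.snoc_init_self i
    rw [← hz] at h ⊢
    rw [mem_polarCode_succ] at h
    rcases zmod_two_cases (i (Fin.last n)) with hb | hb
    · rw [hb] at h ⊢
      rw [leftWord_transform_zero] at h
      exact ih h.1
    · rw [hb] at h ⊢
      rw [rightWord_transform_one] at h
      exact ih h.2

theorem sum_idx_succ {n : ℕ} {M : Type*} [AddCommMonoid M] (f : Idx (n + 1) → M) :
    ∑ z, f z = ∑ z : Idx n, (f (Fin.snoc z 0) + f (Fin.snoc z 1)) := by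
  rw [← (Fin.snocEquiv fun _ => ZMod 2).sum_comp, Fintype.sum_prod_type, Finset.sum_add_distrib]
  exact Fin.sum_univ_two (fun b : ZMod 2 => ∑ z : Idx n, f (Fin.snoc z b))

theorem half_zero_compl_zero {n : ℕ} : half 0 ({0}ᶜ : Set (Idx (n + 1))) = {0}ᶜ := by
  ext z
  change ¬ ((Fin.snoc z 0 : Idx (n + 1)) = 0) ↔ ¬ (z = 0)
  refine not_congr ⟨fun h => ?_, fun h => ?_⟩
  · funext k; simpa using congrFun h k.castSucc
  · subst h; funext k; refine Fin.lastCases ?_ (fun k => ?_) k <;> simp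

theorem half_one_compl_zero {n : ℕ} : half 1 ({0}ᶜ : Set (Idx (n + 1))) = Set.univ := by
  refine Set.eq_univ_of_forall fun z => ?_
  change ¬ ((Fin.snoc z 1 : Idx (n + 1)) = 0)
  intro h
  simpa using congrFun h (Fin.last n)

/-- Freezing only index `0` gives the single parity-check code: row `0` is the indicator of one
point, and all other rows have even weight. -/
theorem mem_polarCode_compl_zero {n : ℕ} {c : Word n} :
    c ∈ polarCode ({0}ᶜ : Set (Idx n)) ↔ ∑ z, c z = 0 := by
  induction n with
  | zero =>
    have h : ({0}ᶜ : Set (Idx 0)) = ∅ :=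
      Set.eq_empty_of_forall_notMem fun z hz => hz (Subsingleton.elim _ _)
    rw [h, polarCode_empty, Submodule.mem_bot, Fintype.sum_subsingleton _ (0 : Idx 0)]
    exact ⟨fun h => congrFun h 0, fun h => funext fun z => Subsingleton.elim (0 : Idx 0) z ▸ h⟩
  | succ n ih =>
    rw [mem_polarCode_succ, half_zero_compl_zero, half_one_compl_zero, ih, polarCode_univ, sum_idx_succ]
    simp [leftWord_apply]

/-! ### Decoding and sign changes by codewords -/

/-- The received signal with its signs changed according to a word. -/
def flip {n : ℕ} (c : Word n) (y : Signal n) : Signal n :=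
  fun z => if c z = 0 then y z else - y z

theorem leftWord_sc {n : ℕ} (I : Set (Idx (n + 1))) (y : Signal (n + 1)) :
    leftWord (sc (n + 1) I y) = sc n (half 0 I) (leftLLR y) := by
  funext z
  simp [leftWord_apply, sc, Fin.init_snoc, add_assoc, zmod_two_add_self]

theorem rightWord_sc {n : ℕ} (I : Set (Idx (n + 1))) (y : Signal (n + 1)) :
    rightWord (sc (n + 1) I y) =
      sc n (half 1 I) (rightLLR (sc n (half 0 I) (leftLLR y)) y) := by
  funext z
  simp [rightWord_apply, sc, Fin.init_snoc]

theorem checkNode_comm (a b : ℝ) : checkNode a b = checkNode b a := by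
  simp [checkNode, min_comm, mul_comm]

theorem checkNode_neg_left (a b : ℝ) : checkNode (-a) b = - checkNode a b := by
  simp [checkNode, Real.sign_neg]

theorem checkNode_neg_right (a b : ℝ) : checkNode a (-b) = - checkNode a b := by
  simp [checkNode, Real.sign_neg]

theorem leftLLR_flip {n : ℕ} (c : Word (n + 1)) (y : Signal (n + 1)) :
    leftLLR (flip c y) = flip (leftWord c) (leftLLR y) := by
  funext z
  simp only [leftLLR, flip, leftWord_apply]
  have h11 : (1 : ZMod 2) + 1 = 0 := rfl
  rcases zmod_two_cases (c (Fin.snoc z 0)) with h0 | h0 <;>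
    rcases zmod_two_cases (c (Fin.snoc z 1)) with h1 | h1 <;>
    simp [h0, h1, h11, checkNode_neg_left, checkNode_neg_right]

theorem rightLLR_flip {n : ℕ} (x : Word n) (c : Word (n + 1)) (y : Signal (n + 1)) :
    rightLLR (x + leftWord c) (flip c y) = flip (rightWord c) (rightLLR x y) := by
  funext z
  simp only [rightLLR, flip, Pi.add_apply, leftWord_apply, rightWord_apply, varNode]
  have h11 : (1 : ZMod 2) + 1 = 0 := rfl
  rcases zmod_two_cases (c (Fin.snoc z 0)) with h0 | h0 <;>
    rcases zmod_two_cases (c (Fin.snoc z 1)) with h1 | h1 <;>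
    rcases zmod_two_cases (x z) with hx | hx <;>
    simp [h0, h1, h11, hx] <;> ring

/-- The sign change passes through the recursion as `leftWord c` and `rightWord c`. At a leaf, the
hard decision flips with the sign only if the value is nonzero. -/
theorem sc_flip {n : ℕ} {I : Set (Idx n)} {y : Signal n} (hy : TieFree n I y) {c : Word n}
    (hc : c ∈ polarCode I) : sc n I (flip c y) = sc n I y + c := by
  induction n with
  | zero =>
    funext z
    by_cases hz : z ∈ I
    · have hne : y z ≠ 0 := hy z hz
      have hs : ∀ w : Signal 0, sc 0 I w z = if w z < 0 then 1 else 0 := fun w => by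
        by_cases hw : w z < 0
        · rw [if_pos hw]; exact if_pos ⟨hz, hw⟩
        · rw [if_neg hw]; exact if_neg fun h => hw h.2
      rw [Pi.add_apply, hs, hs]
      rcases zmod_two_cases (c z) with h | h
      · rw [show flip c y z = y z from if_pos h, h, add_zero]
      · rw [show flip c y z = - y z from if_neg (by rw [h]; exact one_ne_zero), h]
        rcases lt_or_gt_of_ne hne with h' | h'
        · rw [if_neg (by linarith), if_pos h']; rfl
        · rw [if_pos (by linarith), if_neg h'.not_gt]; rfl
    · have hI : I = ∅ := Set.eq_empty_of_forall_notMem fun j hj => hz (Subsingleton.elim j z ▸ hj)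
      rw [hI, polarCode_empty, Submodule.mem_bot] at hc
      simp [sc, hz, hc]
  | succ n ih =>
    obtain ⟨hl, hr⟩ := hy
    obtain ⟨cl, cr⟩ := mem_polarCode_succ.1 hc
    have h0 := ih hl cl
    refine word_ext ?_ ?_
    · rw [leftWord_sc, leftLLR_flip, h0, map_add, leftWord_sc]
    · rw [rightWord_sc, leftLLR_flip, h0, rightLLR_flip, ih hr cr, map_add, rightWord_sc]

theorem tieFree_flip {n : ℕ} {I : Set (Idx n)} {y : Signal n} (hy : TieFree n I y) {c : Word n}
    (hc : c ∈ polarCode I) : TieFree n I (flip c y) := by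
  induction n with
  | zero =>
    intro z hz
    have hne : y z ≠ 0 := hy z hz
    unfold flip
    split_ifs
    · exact hne
    · exact neg_ne_zero.2 hne
  | succ n ih =>
    obtain ⟨hl, hr⟩ := hy
    obtain ⟨cl, cr⟩ := mem_polarCode_succ.1 hc
    refine ⟨leftLLR_flip c y ▸ ih hl cl, ?_⟩
    rw [leftLLR_flip, sc_flip hl cl, rightLLR_flip]
    exact ih hr cr

/-! ### Maximum-likelihood decoding -/

/-- The correlation of a word with a received signal. -/
def corr {n : ℕ} (c : Word n) (y : Signal n) : ℝ := ∑ z, flip c y z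

/-- Successive-cancellation decoding returns a codeword of maximum correlation, which is unique
if no tie is met. -/
def IsML {n : ℕ} (I : Set (Idx n)) : Prop :=
  ∀ y, sc n I y ∈ polarCode I ∧ ∀ c ∈ polarCode I, corr c y ≤ corr (sc n I y) y ∧
    (TieFree n I y → c ≠ sc n I y → corr c y < corr (sc n I y) y)

theorem corr_succ {n : ℕ} (c : Word (n + 1)) (y : Signal (n + 1)) :
    corr c y = corr (rightWord c) (rightLLR (leftWord c) y) := by
  rw [corr, sum_idx_succ, corr]
  refine Finset.sum_congr rfl fun z _ => ?_
  simp only [flip, leftWord_apply, rightWord_apply, rightLLR, varNode]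
  have h11 : (1 : ZMod 2) + 1 = 0 := rfl
  rcases zmod_two_cases (c (Fin.snoc z 0)) with h0 | h0 <;>
    rcases zmod_two_cases (c (Fin.snoc z 1)) with h1 | h1 <;>
    simp [h0, h1, h11] <;> ring

theorem corr_le_sum_abs {n : ℕ} (c : Word n) (y : Signal n) : corr c y ≤ ∑ z, |y z| := by
  refine Finset.sum_le_sum fun z _ => ?_
  unfold flip
  split_ifs
  · exact le_abs_self _
  · exact neg_le_abs _

theorem exists_corr_eq_sum_abs {n : ℕ} (y : Signal n) : ∃ c : Word n, corr c y = ∑ z, |y z| := by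
  classical
  refine ⟨fun z => if y z < 0 then 1 else 0, Finset.sum_congr rfl fun z _ => ?_⟩
  unfold flip
  by_cases h : y z < 0
  · simp [h, abs_of_neg h]
  · simp [h, abs_of_nonneg (not_lt.1 h)]

/-- Rests on `|a + b| - |a - b| = 2 sgn(a) sgn(b) min(|a|, |b|)`. This identity is why the min-sum
rule is exactly maximum-likelihood on the codes below. -/
theorem abs_varNode (u : ZMod 2) (a b : ℝ) :
    |varNode u a b| = (|a + b| + |a - b|) / 2 +
      (if u = 0 then checkNode a b else - checkNode a b) := by
  have key : |b + a| = (|a + b| + |a - b|) / 2 + checkNode a b ∧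
      |b - a| = (|a + b| + |a - b|) / 2 - checkNode a b := by
    rw [add_comm b a, abs_sub_comm b a]
    have h : |a + b| - |a - b| = 2 * checkNode a b := by
      unfold checkNode
      rcases lt_trichotomy a 0 with ha | ha | ha <;> rcases lt_trichotomy b 0 with hb | hb | hb <;>
        (try subst ha) <;> (try subst hb) <;>
        simp only [Real.sign_zero, *, Real.sign_of_neg, Real.sign_of_pos, abs_of_neg, abs_of_pos,
          zero_add, zero_sub, sub_zero, add_zero, abs_neg, sub_self, zero_mul, mul_zero] <;>
        rcases le_total |a| |b| with hab | hab <;>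
        grind
    constructor <;> linarith
  unfold varNode
  split_ifs
  · exact key.1
  · rw [key.2]; ring

/-- Only the last summand depends on `x`, so maximizing the left side over `x` is maximum-likelihood
decoding of `leftLLR y`. -/
theorem sum_abs_rightLLR {n : ℕ} (x : Word n) (y : Signal (n + 1)) :
    ∑ z, |rightLLR x y z| = ∑ z : Idx n, (|y (Fin.snoc z 0) + y (Fin.snoc z 1)| +
      |y (Fin.snoc z 0) - y (Fin.snoc z 1)|) / 2 + corr x (leftLLR y) := by
  rw [corr, ← Finset.sum_add_distrib]
  exact Finset.sum_congr rfl fun z _ => abs_varNode _ _ _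

theorem sc_empty {n : ℕ} (y : Signal n) : sc n ∅ y = 0 := by
  induction n with
  | zero => funext z; simp [sc]
  | succ n ih =>
    refine word_ext ?_ ?_
    · rw [leftWord_sc, half_empty, ih, map_zero]
    · rw [rightWord_sc, half_empty, ih, map_zero]

theorem isML_zero (I : Set (Idx 0)) : IsML I := by
  intro y
  by_cases hI : ∃ o, o ∈ I
  · obtain ⟨o, ho⟩ := hI
    refine ⟨polarCode_zero_of_mem ho _, fun c _ => ?_⟩
    have hc : ∀ d : Word 0, corr d y = if d o = 0 then y o else - y o := fun d =>
      Fintype.sum_subsingleton _ o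
    by_cases hs : y o < 0
    · have hd : sc 0 I y o = 1 := if_pos ⟨ho, hs⟩
      rw [hc, hc, hd, if_neg one_ne_zero]
      refine ⟨by split_ifs <;> linarith, fun _ hne => ?_⟩
      rcases zmod_two_cases (c o) with h | h
      · rw [if_pos h]; linarith
      · exact absurd (funext fun z => by rw [Subsingleton.elim z o, h, hd]) hne
    · have hd : sc 0 I y o = 0 := if_neg fun h => hs h.2
      rw [hc, hc, hd, if_pos rfl]
      refine ⟨by split_ifs <;> linarith, fun ht hne => ?_⟩
      have h0 : y o ≠ 0 := ht o ho
      rcases zmod_two_cases (c o) with h | h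
      · exact absurd (funext fun z => by rw [Subsingleton.elim z o, h, hd]) hne
      · rw [if_neg (by rw [h]; exact one_ne_zero)]
        have := lt_of_le_of_ne (not_lt.1 hs) h0.symm
        linarith
  · have hI' : I = ∅ := Set.eq_empty_of_forall_notMem fun j hj => hI ⟨j, hj⟩
    subst hI'
    rw [sc_empty, polarCode_empty]
    refine ⟨zero_mem _, fun c hc => ?_⟩
    rw [(Submodule.mem_bot _).1 hc]
    exact ⟨le_rfl, fun _ h => absurd rfl h⟩

theorem IsML.of_half_zero_empty {n : ℕ} {I : Set (Idx (n + 1))} (h0 : half 0 I = ∅)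
    (h1 : IsML (half 1 I)) : IsML I := by
  intro y
  obtain ⟨hm, hc⟩ := h1 (rightLLR 0 y)
  have hl : leftWord (sc (n + 1) I y) = 0 := by rw [leftWord_sc, h0, sc_empty]
  have hr : rightWord (sc (n + 1) I y) = sc n (half 1 I) (rightLLR 0 y) := by
    rw [rightWord_sc, h0, sc_empty]
  refine ⟨mem_polarCode_succ.2 ⟨hl ▸ zero_mem _, hr ▸ hm⟩, fun c hcI => ?_⟩
  obtain ⟨cl, cr⟩ := mem_polarCode_succ.1 hcI
  rw [h0, polarCode_empty, Submodule.mem_bot] at cl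
  rw [corr_succ, corr_succ, hl, cl, hr]
  refine ⟨(hc _ cr).1, fun ht hne => (hc _ cr).2 ?_ fun h => hne ?_⟩
  · have := ht.2
    rwa [h0, sc_empty] at this
  · exact word_ext (cl.trans hl.symm) (h.trans hr.symm)

/-- An unconstrained right word attains the sum of absolute values, so the choice of the left word
alone decides optimality. The hypothesis `hu` avoids circularity: `isML_univ` is itself proved by
this lemma. -/
theorem IsML.of_half_one_univ_aux {n : ℕ} {I : Set (Idx (n + 1))} (h1 : half 1 I = Set.univ)
    (hu : IsML (Set.univ : Set (Idx n))) (h0 : IsML (half 0 I)) : IsML I := by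
  intro y
  obtain ⟨hm, hc⟩ := h0 (leftLLR y)
  have hl := leftWord_sc I y
  have hr := rightWord_sc I y
  rw [h1] at hr
  set u := sc n (half 0 I) (leftLLR y) with hudef
  obtain ⟨-, hc'⟩ := hu (rightLLR u y)
  rw [polarCode_univ] at hc'
  have hmax : corr (sc n Set.univ (rightLLR u y)) (rightLLR u y) = ∑ z, |rightLLR u y z| := by
    obtain ⟨d, hd⟩ := exists_corr_eq_sum_abs (rightLLR u y)
    exact le_antisymm (corr_le_sum_abs _ _) (hd ▸ (hc' d trivial).1)
  refine ⟨mem_polarCode_succ.2 ⟨hl ▸ hm, ?_⟩, fun c hcI => ?_⟩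
  · rw [h1, polarCode_univ]; trivial
  obtain ⟨cl, -⟩ := mem_polarCode_succ.1 hcI
  have hle : corr c y ≤ ∑ z, |rightLLR (leftWord c) y z| := by
    rw [corr_succ]; exact corr_le_sum_abs _ _
  have heq : corr (sc (n + 1) I y) y = ∑ z, |rightLLR u y z| := by
    rw [corr_succ, hl, hr, hmax]
  rw [sum_abs_rightLLR] at hle
  constructor
  · rw [heq, sum_abs_rightLLR]
    linarith [(hc _ cl).1]
  · rintro ⟨htl, htr⟩ hne
    by_cases hcl : leftWord c = u
    · rw [h1, ← hudef] at htr
      rw [corr_succ, corr_succ (sc (n + 1) I y), hl, hr, hcl]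
      exact (hc' _ trivial).2 htr fun h => hne (word_ext (hcl.trans hl.symm) (h.trans hr.symm))
    · rw [heq, sum_abs_rightLLR]
      linarith [(hc _ cl).2 htl hcl]

theorem isML_univ {n : ℕ} : IsML (Set.univ : Set (Idx n)) := by
  induction n with
  | zero => exact isML_zero _
  | succ n ih => exact IsML.of_half_one_univ_aux rfl ih ih

theorem IsML.of_half_one_univ {n : ℕ} {I : Set (Idx (n + 1))} (h1 : half 1 I = Set.univ)
    (h0 : IsML (half 0 I)) : IsML I :=
  IsML.of_half_one_univ_aux h1 isML_univ h0

theorem corr_permute {n : ℕ} (π : Equiv.Perm (Idx n)) (c : Word n) (y : Signal n) :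
    corr (permute π c) (permute π y) = corr c y :=
  Equiv.sum_comp π (flip c y)

/-- A maximum-likelihood decoder commutes with the automorphisms of the code. -/
theorem IsML.sc_permute {n : ℕ} {I : Set (Idx n)} (hI : IsML I) {π : Equiv.Perm (Idx n)}
    (hπ : ∀ σ ∈ ({π, π⁻¹} : Set (Equiv.Perm (Idx n))), ∀ c ∈ polarCode I,
      permute σ c ∈ polarCode I)
    {y : Signal n} (hy : TieFree n I y) :
    sc n I (permute π y) = permute π (sc n I y) := by
  have hcancel : permute π (permute π⁻¹ (sc n I (permute π y))) = sc n I (permute π y) := by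
    funext z; simp [permute]
  suffices h : permute π⁻¹ (sc n I (permute π y)) = sc n I y by rw [← hcancel, h]
  by_contra hne
  -- Strict optimality is used at `y` only; at `permute π y`, where ties are not excluded, the weak
  -- inequality suffices.
  have h1 := ((hI y).2 _ (hπ π⁻¹ (by simp) _ (hI (permute π y)).1)).2 hy hne
  have h2 := ((hI (permute π y)).2 _ (hπ π (by simp) _ (hI y).1)).1
  rw [corr_permute] at h2
  rw [← corr_permute π, hcancel] at h1
  exact absurd h1 (not_lt.2 h2)


/-! ### Codes of length four -/

theorem half_zero_singleton_one {n : ℕ} : half 0 ({1} : Set (Idx (n + 1))) = ∅ := by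
  refine Set.eq_empty_of_forall_notMem fun z hz => ?_
  have h : (Fin.snoc z 0 : Idx (n + 1)) = 1 := hz
  simpa using congrFun h (Fin.last n)

theorem half_one_singleton_one {n : ℕ} : half 1 ({1} : Set (Idx (n + 1))) = {1} := by
  ext z
  change (Fin.snoc z 1 : Idx (n + 1)) = 1 ↔ z = 1
  refine ⟨fun h => ?_, fun h => ?_⟩
  · funext k; simpa using congrFun h k.castSucc
  · subst h; funext k; refine Fin.lastCases ?_ (fun k => ?_) k <;> simp

theorem isML_empty {n : ℕ} : IsML (∅ : Set (Idx n)) := by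
  induction n with
  | zero => exact isML_zero _
  | succ n ih => exact IsML.of_half_zero_empty (half_empty 0) ih

/-- Here `1` is the all-ones index `2 ^ n - 1`, whose row is constant: the repetition code. -/
theorem isML_singleton_one {n : ℕ} : IsML ({1} : Set (Idx n)) := by
  induction n with
  | zero => exact isML_zero _
  | succ n ih =>
    exact IsML.of_half_zero_empty half_zero_singleton_one
      (by rwa [half_one_singleton_one])

theorem isML_compl_zero {n : ℕ} : IsML ({0}ᶜ : Set (Idx n)) := by
  induction n with
  | zero => exact isML_zero _
  | succ n ih =>
    exact IsML.of_half_one_univ half_one_compl_zero (by rwa [half_zero_compl_zero])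

theorem permute_mem_polarCode_singleton_one {n : ℕ} (π : Equiv.Perm (Idx n)) {c : Word n}
    (hc : c ∈ polarCode ({1} : Set (Idx n))) :
    permute π c ∈ polarCode ({1} : Set (Idx n)) := by
  suffices h : permute π c = c by rwa [h]
  have h1 : (transform n '' {1} : Set (Word n)) = {fun _ => 1} := by
    refine (Set.image_singleton (f := (transform n : Idx n → Word n))).trans ?_
    congr 1
    funext z
    simp [transform, kernel]
  rw [polarCode, h1, Submodule.mem_span_singleton] at hc
  obtain ⟨a, rfl⟩ := hc
  rfl

theorem permute_mem_polarCode_compl_zero {n : ℕ} (π : Equiv.Perm (Idx n)) {c : Word n}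
    (hc : c ∈ polarCode ({0}ᶜ : Set (Idx n))) :
    permute π c ∈ polarCode ({0}ᶜ : Set (Idx n)) := by
  rw [mem_polarCode_compl_zero] at hc ⊢
  rw [← hc]
  exact Equiv.sum_comp π c

/-- The closure properties of the information set of a decreasing monomial code that is invariant
under the exchange of the two least significant bits. -/
structure IsStable {n : ℕ} (I : Set (Idx (n + 2))) : Prop where
  up : ∀ i ∈ I, ∀ k, Function.update i k 1 ∈ I
  shift : ∀ i ∈ I, ∀ l k, l < k → i k = 0 → i l = 1 →
    Function.update (Function.update i k 1) l 0 ∈ I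
  swap : ∀ i ∈ I, i ∘ Equiv.swap 0 1 ∈ I

theorem IsStable.half {n : ℕ} {I : Set (Idx (n + 3))} (h : IsStable I) (b : ZMod 2) :
    IsStable (half b I) where
  up i hi k := by
    have := h.up _ hi k.castSucc
    rwa [← Fin.snoc_update] at this
  shift i hi l k hlk hk hl := by
    have := h.shift _ hi l.castSucc k.castSucc (by simpa using hlk) (by simpa using hk)
      (by simpa using hl)
    rwa [← Fin.snoc_update, ← Fin.snoc_update] at this
  swap i hi := by
    have := h.swap _ hi
    have e : (Fin.snoc i b : Idx (n + 3)) ∘ Equiv.swap 0 1 =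
        Fin.snoc (i ∘ Equiv.swap 0 1) b := by
      funext k
      refine Fin.lastCases ?_ (fun k => ?_) k
      · have : Equiv.swap (0 : Fin (n + 3)) 1 (Fin.last _) = Fin.last _ :=
          Equiv.swap_apply_of_ne_of_ne (by simp [Fin.ext_iff]) (by simp [Fin.ext_iff])
        simp [this]
      · have : Equiv.swap (0 : Fin (n + 3)) 1 k.castSucc = (Equiv.swap 0 1 k).castSucc := by
          have := (Fin.castSucc_injective (n + 2)).swap_apply 0 1 k
          simpa using this
        simp [this]
    rwa [e] at this

theorem IsStable.length_four_cases {I : Set (Idx (0 + 2))} (h : IsStable I) :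
    I = ∅ ∨ I = {1} ∨ I = {0}ᶜ ∨ I = Set.univ := by
  -- Any index other than `(1, 1)` reaches every nonzero index by setting bits to `1` and exchanging
  -- the two bits.
  have key : ∀ i j : Fin 2 → ZMod 2, i ≠ 1 → j ≠ 0 → j = i ∨ j = i ∘ Equiv.swap 0 1 ∨
      j = Function.update i 0 1 ∨ j = Function.update i 1 1 ∨
      j = Function.update (Function.update i 0 1) 1 1 := by
    set_option synthInstance.maxSize 1000 in
    decide
  have hmem : ∀ i ∈ I, i ≠ 1 → ∀ j, j ≠ 0 → j ∈ I := by
    intro i hi h1 j h0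
    rcases key i j h1 h0 with e | e | e | e | e <;> rw [e]
    · exact hi
    · exact h.swap i hi
    · exact h.up i hi 0
    · exact h.up i hi 1
    · exact h.up _ (h.up i hi 0) 1
  by_cases h0 : (0 : Idx (0 + 2)) ∈ I
  · refine Or.inr <| Or.inr <| Or.inr <| Set.eq_univ_of_forall fun j => ?_
    by_cases hj : j = 0
    · rwa [hj]
    · exact hmem 0 h0 (by decide) j hj
  · by_cases h1 : ∃ i ∈ I, i ≠ 1
    · obtain ⟨i, hi, hi1⟩ := h1
      refine Or.inr <| Or.inr <| Or.inl <| Set.ext fun j => ⟨fun hj => ?_, hmem i hi hi1 j⟩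
      rintro rfl
      exact h0 hj
    · push Not at h1
      rcases Set.eq_empty_or_nonempty I with he | ⟨i, hi⟩
      · exact Or.inl he
      · refine Or.inr <| Or.inl <| Set.ext fun j => ⟨h1 j, ?_⟩
        rintro rfl
        exact h1 i hi ▸ hi

theorem IsStable.isML {I : Set (Idx (0 + 2))} (h : IsStable I) : IsML I := by
  rcases h.length_four_cases with rfl | rfl | rfl | rfl
  · exact isML_empty
  · exact isML_singleton_one
  · exact isML_compl_zero
  · exact isML_univ

theorem IsStable.permute_mem {I : Set (Idx (0 + 2))} (h : IsStable I)
    (π : Equiv.Perm (Idx (0 + 2))) {c : Word (0 + 2)} (hc : c ∈ polarCode I) :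
    permute π c ∈ polarCode I := by
  rcases h.length_four_cases with rfl | rfl | rfl | rfl
  · rw [polarCode_empty, Submodule.mem_bot] at hc ⊢
    subst hc
    rfl
  · exact permute_mem_polarCode_singleton_one π hc
  · exact permute_mem_polarCode_compl_zero π hc
  · rw [polarCode_univ]; trivial

/-! ### Products of codewords with affine functions -/

theorem transform_update_zero {n : ℕ} (i z : Idx n) (k : Fin n) :
    transform n (Function.update i k 0) z = (1 + z k) * transform n i z := by
  have h : ∀ j : Idx n, transform n j z =
      kernel (j k) (z k) * ∏ l ∈ Finset.univ.erase k, kernel (j l) (z l) := fun j =>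
    (Finset.mul_prod_erase _ _ (Finset.mem_univ k)).symm
  have e : ∏ l ∈ Finset.univ.erase k, kernel (Function.update i k 0 l) (z l) =
      ∏ l ∈ Finset.univ.erase k, kernel (i l) (z l) :=
    Finset.prod_congr rfl fun l hl => by rw [Function.update_of_ne (Finset.ne_of_mem_erase hl)]
  have hk : ∀ a b : ZMod 2, kernel 0 b = (1 + b) * kernel a b := by decide
  rw [h, h, e, Function.update_self, hk (i k), mul_assoc]

theorem IsStable.half_zero_subset {n : ℕ} {I : Set (Idx (n + 2))} (h : IsStable I) {i : Idx (n + 1)}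
    (hi : i ∈ PolarSC.half 0 I) : i ∈ PolarSC.half 1 I := by
  have := h.up _ hi (Fin.last _)
  rwa [Fin.update_snoc_last] at this

/-- An index in `half 0 I` is a monomial divisible by the last variable. Trading that variable for
variable `k` gives an antecedent; if `k` already occurs, dropping the last variable gives a factor.
-/
theorem IsStable.update_zero_mem {n : ℕ} {I : Set (Idx (n + 2))} (h : IsStable I)
    {i : Idx (n + 1)} (hi : i ∈ PolarSC.half 0 I) (k : Fin (n + 1)) :
    Function.update i k 0 ∈ PolarSC.half 1 I := by
  rcases zmod_two_cases (i k) with hk | hk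
  · rw [← hk, Function.update_eq_self]
    exact h.half_zero_subset hi
  · have := h.shift _ hi k.castSucc (Fin.last _) (Fin.castSucc_lt_last k) (by simp) (by simpa)
    rwa [Fin.update_snoc_last, ← Fin.snoc_update] at this

/-- Multiplication by an affine function maps the code of the first half into that of the second
half. -/
theorem IsStable.affine_mul_mem {n : ℕ} {I : Set (Idx (n + 2))} (h : IsStable I)
    {x : Word (n + 1)} (hx : x ∈ polarCode (PolarSC.half 0 I)) (a : Idx (n + 1)) (b : ZMod 2) :
    (fun w => (a ⬝ᵥ w + b) * x w) ∈ polarCode (PolarSC.half 1 I) := by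
  have h0 : ∀ x ∈ polarCode (PolarSC.half 0 I), x ∈ polarCode (PolarSC.half 1 I) := by
    refine fun x hx => Submodule.span_mono ?_ hx
    rintro _ ⟨i, hi, rfl⟩
    exact ⟨i, h.half_zero_subset hi, rfl⟩
  have h1 : ∀ (k : Fin (n + 1)), ∀ x ∈ polarCode (PolarSC.half 0 I),
      (fun w => (1 + w k) * x w) ∈ polarCode (PolarSC.half 1 I) := by
    intro k x hx
    induction hx using Submodule.span_induction with
    | mem x hx =>
      obtain ⟨i, hi, rfl⟩ := hx
      have e : (fun w : Idx (n + 1) => (1 + w k) * transform (n + 1) i w) =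
          transform (n + 1) (Function.update i k 0) := by
        funext w; rw [transform_update_zero]
      rw [e]
      exact transform_mem_polarCode (h.update_zero_mem hi k)
    | zero =>
      have e : (fun w : Idx (n + 1) => (1 + w k) * (0 : Word (n + 1)) w) = 0 := by
        funext w; simp
      rw [e]
      exact zero_mem _
    | add x y _ _ hx hy =>
      have e : (fun w : Idx (n + 1) => (1 + w k) * (x + y) w) =
          (fun w => (1 + w k) * x w) + fun w => (1 + w k) * y w := by
        funext w; simp [mul_add]
      rw [e]
      exact add_mem hx hy
    | smul a x _ hx =>
      have e : (fun w : Idx (n + 1) => (1 + w k) * (a • x) w) =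
          a • fun w => (1 + w k) * x w := by
        funext w; simp; ring
      rw [e]
      exact Submodule.smul_mem _ _ hx
  -- Writes each `w k` as `(1 + w k) - 1`, since the factors `1 + w k` are what act on rows.
  have e : (fun w => (a ⬝ᵥ w + b) * x w) =
      b • x + ∑ k, a k • ((fun w : Idx (n + 1) => (1 + w k) * x w) - x) := by
    funext w
    simp only [dotProduct, Pi.add_apply, Pi.smul_apply, Finset.sum_apply, Pi.sub_apply,
      smul_eq_mul, add_mul, Finset.sum_mul]
    rw [add_comm]
    congr 1
    exact Finset.sum_congr rfl fun k _ => by ring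
  rw [e]
  exact add_mem (Submodule.smul_mem _ _ (h0 x hx)) <| Submodule.sum_mem _ fun k _ =>
    Submodule.smul_mem _ _ (sub_mem (h1 k x hx) (h0 x hx))

theorem sc_mem_polarCode {n : ℕ} (I : Set (Idx n)) (y : Signal n) : sc n I y ∈ polarCode I := by
  induction n with
  | zero => exact (isML_zero I y).1
  | succ n ih =>
    rw [mem_polarCode_succ, leftWord_sc, rightWord_sc]
    exact ⟨ih _ _, ih _ _⟩

/-! ### Equivariance of successive-cancellation decoding -/

/-! A permutation that acts on the low-order bits by `σ` and adds `f` of the low-order bits to the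
most significant bit respects the recursion of the decoder. -/

theorem leftLLR_permute {n : ℕ} {π : Equiv.Perm (Idx (n + 1))} {σ : Equiv.Perm (Idx n)}
    {f : Idx n → ZMod 2} (h : ∀ w b, π (Fin.snoc w b) = Fin.snoc (σ w) (b + f w))
    (y : Signal (n + 1)) : leftLLR (permute π y) = permute σ (leftLLR y) := by
  funext w
  simp only [leftLLR, permute, h]
  rcases zmod_two_cases (f w) with hf | hf
  · simp [hf]
  · rw [hf, zero_add, zmod_two_add_self, checkNode_comm]

theorem rightLLR_permute {n : ℕ} {π : Equiv.Perm (Idx (n + 1))} {σ : Equiv.Perm (Idx n)}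
    {f : Idx n → ZMod 2} (h : ∀ w b, π (Fin.snoc w b) = Fin.snoc (σ w) (b + f w))
    (x : Word n) (y : Signal (n + 1)) :
    rightLLR (permute σ x) (permute π y) =
      permute σ (flip (fun w => f (σ.symm w) * x w) (rightLLR x y)) := by
  funext w
  simp only [rightLLR, permute, flip, varNode, h, Equiv.symm_apply_apply]
  rcases zmod_two_cases (f w) with hf | hf
  · simp [hf]
  · rcases zmod_two_cases (x (σ w)) with hx | hx
    · simp [hf, hx, zmod_two_add_self, add_comm]
    · simp [hf, hx, zmod_two_add_self]

theorem leftWord_permute {n : ℕ} {π : Equiv.Perm (Idx (n + 1))} {σ : Equiv.Perm (Idx n)}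
    {f : Idx n → ZMod 2} (h : ∀ w b, π (Fin.snoc w b) = Fin.snoc (σ w) (b + f w))
    (x : Word (n + 1)) : leftWord (permute π x) = permute σ (leftWord x) := by
  funext w
  simp only [leftWord_apply, permute, h]
  rcases zmod_two_cases (f w) with hf | hf
  · simp [hf]
  · rw [hf, zero_add, zmod_two_add_self, add_comm]

theorem rightWord_permute {n : ℕ} {π : Equiv.Perm (Idx (n + 1))} {σ : Equiv.Perm (Idx n)}
    {f : Idx n → ZMod 2} (h : ∀ w b, π (Fin.snoc w b) = Fin.snoc (σ w) (b + f w))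
    (x : Word (n + 1)) : rightWord (permute π x) =
      permute σ (rightWord x + fun w => f (σ.symm w) * leftWord x w) := by
  funext w
  simp only [rightWord_apply, leftWord_apply, permute, h, Pi.add_apply,
    Equiv.symm_apply_apply]
  rcases zmod_two_cases (f w) with hf | hf
  · simp [hf]
  · rw [hf, zmod_two_add_self, one_mul, add_left_comm, zmod_two_add_self, add_zero]

/-- Bijectivity of the map yields invertibility of the matrix, so the recursion need not track it
for submatrices. -/
theorem IsAffineMap.isUnit {n : ℕ} {σ : Equiv.Perm (Idx n)}
    {A : Matrix (Fin n) (Fin n) (ZMod 2)} {b : Idx n} (h : IsAffineMap σ A b) : IsUnit A := by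
  rw [← Matrix.mulVec_surjective_iff_isUnit]
  intro v
  obtain ⟨w, hw⟩ := σ.surjective (v + b)
  refine ⟨w, add_right_cancel (b := b) ?_⟩
  rw [← h w, hw]

theorem IsAffineMap.symm_apply {n : ℕ} {σ : Equiv.Perm (Idx n)}
    {A : Matrix (Fin n) (Fin n) (ZMod 2)} {b : Idx n} (h : IsAffineMap σ A b) (v : Idx n) :
    σ.symm v = A⁻¹.mulVec (v - b) := by
  have h' := h (σ.symm v)
  rw [Equiv.apply_symm_apply] at h'
  rw [eq_comm, h', add_sub_cancel_right, Matrix.mulVec_mulVec,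
    Matrix.nonsing_inv_mul _ ((Matrix.isUnit_iff_isUnit_det _).1 h.isUnit), Matrix.one_mulVec, ← h']

/-- The last coordinate splits off an affine permutation that is lower triangular in its last
column. -/
theorem IsAffineMap.exists_init {n : ℕ} {π : Equiv.Perm (Idx (n + 1))}
    {A : Matrix (Fin (n + 1)) (Fin (n + 1)) (ZMod 2)} {b : Idx (n + 1)} (h : IsAffineMap π A b)
    (hA : ∀ i, i < Fin.last n → A i (Fin.last n) = 0) :
    ∃ σ : Equiv.Perm (Idx n),
      IsAffineMap σ (A.submatrix Fin.castSucc Fin.castSucc) (Fin.init b) ∧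
      ∀ w c, π (Fin.snoc w c) =
        Fin.snoc (σ w) (c + ((fun j : Fin n => A (Fin.last n) j.castSucc) ⬝ᵥ w +
          b (Fin.last n))) := by
  have hcs : ∀ w c (k : Fin n), π (Fin.snoc w c) k.castSucc =
      ((A.submatrix Fin.castSucc Fin.castSucc).mulVec w + Fin.init b) k := by
    intro w c k
    rw [h]
    simp [Matrix.mulVec, dotProduct, Fin.sum_univ_castSucc, hA _ (Fin.castSucc_lt_last k),
      Fin.init]
  have hlast : ∀ w c, π (Fin.snoc w c) (Fin.last n) =
      A (Fin.last n) (Fin.last n) * c + ((fun j : Fin n => A (Fin.last n) j.castSucc) ⬝ᵥ w +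
          b (Fin.last n)) := by
    intro w c
    rw [h]
    simp [Matrix.mulVec, dotProduct, Fin.sum_univ_castSucc]
    ring
  have hsurj : Function.Surjective fun w : Idx n =>
      (A.submatrix Fin.castSucc Fin.castSucc).mulVec w + Fin.init b := by
    intro v
    obtain ⟨u, hu⟩ := π.surjective (Fin.snoc v 0)
    refine ⟨Fin.init u, funext fun k => ?_⟩
    rw [← Fin.snoc_init_self u] at hu
    have := congrFun hu k.castSucc
    rw [hcs] at this
    simpa using this
  -- With a zero corner, the whole last column would vanish and `π` would ignore the last
  -- coordinate.
  have hone : A (Fin.last n) (Fin.last n) = 1 := by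
    refine (zmod_two_cases _).resolve_left fun h0 => ?_
    have : π (Fin.snoc 0 0) = π (Fin.snoc 0 1) := by
      funext k
      refine Fin.lastCases ?_ (fun k => ?_) k
      · rw [hlast, hlast, h0, zero_mul, zero_mul]
      · rw [hcs, hcs]
    simpa using congrFun (π.injective this) (Fin.last n)
  refine ⟨Equiv.ofBijective _ (Finite.surjective_iff_bijective.1 hsurj), fun z => rfl,
    fun w c => funext fun k => ?_⟩
  refine Fin.lastCases ?_ (fun k => ?_) k
  · rw [hlast, hone, one_mul, Fin.snoc_last]
  · rw [hcs, Fin.snoc_castSucc]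
    rfl

/-- The block shape `(2, 1, …, 1)` is stated entrywise in `hA` so that it passes to the leading
submatrix. -/
theorem IsStable.sc_permute {n : ℕ} {I : Set (Idx (n + 2))} (hI : IsStable I)
    {π : Equiv.Perm (Idx (n + 2))} {A : Matrix (Fin (n + 2)) (Fin (n + 2)) (ZMod 2)}
    {b : Idx (n + 2)} (hπ : IsAffineMap π A b)
    (hA : ∀ i j : Fin (n + 2), i < j → 2 ≤ (j : ℕ) → A i j = 0)
    {y : Signal (n + 2)} (hy : TieFree (n + 2) I y) :
    sc (n + 2) I (permute π y) = permute π (sc (n + 2) I y) := by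
  induction n with
  | zero => exact hI.isML.sc_permute (fun σ _ c hc => hI.permute_mem σ hc) hy
  | succ n ih =>
    obtain ⟨σ, hσ, h⟩ := hπ.exists_init fun i hi => hA i _ hi (by simp)
    have hA' : ∀ i j : Fin (n + 2), i < j → 2 ≤ (j : ℕ) →
        A.submatrix Fin.castSucc Fin.castSucc i j = 0 := fun i j hij hj =>
      hA _ _ (by simpa using hij) (by simpa using hj)
    obtain ⟨htl, htr⟩ := hy
    have hl := ih (hI.half 0) hσ hA' htl
    set a : Idx (n + 2) := fun j => A (Fin.last _) j.castSucc
    set x := sc (n + 2) (PolarSC.half 0 I) (leftLLR y) with hx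
    -- The flip pattern on the right half: `f ∘ σ⁻¹` is affine because `σ` is, so its product with
    -- `x` is a right codeword.
    have hc : (fun w => (a ⬝ᵥ σ.symm w + b (Fin.last _)) * x w) ∈ polarCode (PolarSC.half 1 I) := by
      have := hI.affine_mul_mem (sc_mem_polarCode (PolarSC.half 0 I) (leftLLR y))
        (Matrix.vecMul a (A.submatrix Fin.castSucc Fin.castSucc)⁻¹)
        (b (Fin.last _) - a ⬝ᵥ (A.submatrix Fin.castSucc Fin.castSucc)⁻¹.mulVec (Fin.init b))
      convert this using 3 with w
      rw [hσ.symm_apply, Matrix.mulVec_sub, dotProduct_sub, Matrix.dotProduct_mulVec]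
      ring
    refine word_ext ?_ ?_
    · rw [leftWord_sc, leftLLR_permute h, hl, leftWord_permute h, leftWord_sc]
    · rw [rightWord_sc, leftLLR_permute h, hl, rightLLR_permute h, rightWord_permute h,
        rightWord_sc, leftWord_sc, ← hx]
      rw [ih (hI.half 1) hσ hA' (tieFree_flip htr hc), sc_flip htr hc]


/-! ### Information sets of decreasing monomial codes -/

theorem mem_rowMonomial {n : ℕ} {i : Idx n} {k : Fin n} : k ∈ rowMonomial i ↔ i k = 0 := by
  simp [rowMonomial]

theorem rowMonomial_injective {n : ℕ} : Function.Injective (rowMonomial (n := n)) := by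
  intro i j h
  funext k
  have hk : i k = 0 ↔ j k = 0 := by rw [← mem_rowMonomial, h, mem_rowMonomial]
  rcases zmod_two_cases (i k) with hi | hi <;> rcases zmod_two_cases (j k) with hj | hj <;>
    simp_all

theorem rowMonomial_mem_generatingMonomials {n : ℕ} {I : Set (Idx n)} {i : Idx n} :
    rowMonomial i ∈ generatingMonomials I ↔ i ∈ I :=
  rowMonomial_injective.mem_set_image

theorem isAntecedent_map {n : ℕ} (φ : Equiv.Perm (Fin n)) (M : Finset (Fin n))
    (h : ∀ x ∈ M, φ x ≤ x) : IsAntecedent (M.map φ.toEmbedding) M := by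
  refine ⟨Finset.card_map _, fun l => ?_⟩
  by_contra hlt
  rw [not_le] at hlt
  have hex : ∀ j : Fin M.card, ∃ j' : Fin M.card,
      (M.map φ.toEmbedding).orderEmbOfFin (Finset.card_map _) j' = φ (M.orderEmbOfFin rfl j) := by
    intro j
    have hmem : φ (M.orderEmbOfFin rfl j) ∈ ((M.map φ.toEmbedding : Finset (Fin n)) : Set _) :=
      Finset.mem_map_of_mem φ.toEmbedding (Finset.orderEmbOfFin_mem M rfl j)
    rw [← Finset.range_orderEmbOfFin _ (Finset.card_map φ.toEmbedding)] at hmem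
    exact hmem
  choose ψ hψ using hex
  -- Pigeonhole: the `l + 1` smallest elements of `M` have images below the `l`-th element of the
  -- image set, where only `l` places exist.
  have hmaps : ∀ j ∈ Finset.Iic l, ψ j ∈ Finset.Iio l := by
    intro j hj
    rw [Finset.mem_Iic] at hj
    rw [Finset.mem_Iio, ← ((M.map φ.toEmbedding).orderEmbOfFin (Finset.card_map _)).lt_iff_lt, hψ]
    exact ((h _ (Finset.orderEmbOfFin_mem M rfl j)).trans
      ((M.orderEmbOfFin rfl).monotone hj)).trans_lt hlt
  have hinj : Function.Injective ψ := by
    intro j j' e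
    have := hψ j
    rw [e, hψ] at this
    exact ((M.orderEmbOfFin rfl).injective (φ.injective this)).symm
  have hcard := Finset.card_le_card_of_injOn ψ hmaps hinj.injOn
  rw [Fin.card_Iic, Fin.card_Iio] at hcard
  omega

theorem IsDecreasing.update_one_mem {n : ℕ} {I : Set (Idx n)}
    (h : IsDecreasing (generatingMonomials I)) {i : Idx n} (hi : i ∈ I) (k : Fin n) :
    Function.update i k 1 ∈ I := by
  rw [← rowMonomial_mem_generatingMonomials] at hi ⊢
  refine h.1 _ hi _ fun l hl => ?_
  rw [mem_rowMonomial] at hl ⊢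
  by_cases hlk : l = k
  · subst hlk; simp at hl
  · rwa [Function.update_of_ne hlk] at hl

theorem IsDecreasing.shift_mem {n : ℕ} {I : Set (Idx n)}
    (h : IsDecreasing (generatingMonomials I)) {i : Idx n} (hi : i ∈ I) {l k : Fin n}
    (hlk : l < k) (hk : i k = 0) (hl : i l = 1) :
    Function.update (Function.update i k 1) l 0 ∈ I := by
  rw [← rowMonomial_mem_generatingMonomials] at hi ⊢
  have e : rowMonomial (Function.update (Function.update i k 1) l 0) =
      (rowMonomial i).map (Equiv.swap k l).toEmbedding := by
    ext m
    rw [Finset.mem_map_equiv, mem_rowMonomial, mem_rowMonomial, Equiv.symm_swap]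
    by_cases hml : m = l
    · subst hml; simp [hk]
    · by_cases hmk : m = k
      · subst hmk; simp [hml, hl]
      · rw [Equiv.swap_apply_of_ne_of_ne hmk hml, Function.update_of_ne hml,
          Function.update_of_ne hmk]
  rw [e]
  refine h.2 _ hi _ (isAntecedent_map _ _ fun m hm => ?_)
  rw [mem_rowMonomial] at hm
  by_cases hmk : m = k
  · subst hmk; simpa using hlk.le
  · by_cases hml : m = l
    · subst hml; rw [hl] at hm; exact absurd hm one_ne_zero
    · rw [Equiv.swap_apply_of_ne_of_ne hmk hml]

/-! ### Block structures -/

theorem index_mono {n : ℕ} (S : Composition n) {i j : Fin n} (h : i ≤ j) :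
    S.index i ≤ S.index j := by
  by_contra hlt
  rw [not_le] at hlt
  have h1 := S.sizeUpTo_index_le i
  have h2 : (j : ℕ) < S.sizeUpTo ((S.index j : ℕ) + 1) := S.lt_sizeUpTo_index_succ j
  have h3 : S.sizeUpTo ((S.index j : ℕ) + 1) ≤ S.sizeUpTo (S.index i) :=
    S.monotone_sizeUpTo (Nat.succ_le_of_lt (Fin.lt_def.1 hlt))
  have h4 := Fin.le_def.1 h
  omega

theorem index_zero_eq_index_one {n : ℕ} (S : Composition (n + 2)) (hS : 1 < S.blocks.headD 0) :
    S.index 0 = S.index 1 := by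
  refine le_antisymm (index_mono S (Fin.zero_le _)) ?_
  by_contra hlt
  rw [not_le] at hlt
  have h1 := S.sizeUpTo_index_le 1
  have h2 : 1 ≤ (S.index 1 : ℕ) := by have := Fin.lt_def.1 hlt; omega
  have h3 := S.monotone_sizeUpTo h2
  -- If position `1` were outside the first block, that block would have size at most `1`.
  have h4 : S.sizeUpTo 1 = S.blocks.headD 0 := by
    unfold Composition.sizeUpTo
    rcases S.blocks with _ | ⟨a, l⟩ <;> simp
  simp only [Fin.val_one] at h1
  omega

theorem twoOnes_index_lt {n : ℕ} (hn : 2 ≤ n) {i j : Fin n} (hij : i < j) (hj : 2 ≤ (j : ℕ)) :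
    (twoOnes n hn).index i < (twoOnes n hn).index j := by
  by_contra hle
  rw [not_lt] at hle
  have h1 := (twoOnes n hn).sizeUpTo_index_le i
  have h2 : (j : ℕ) < (twoOnes n hn).sizeUpTo (((twoOnes n hn).index j : ℕ) + 1) :=
    (twoOnes n hn).lt_sizeUpTo_index_succ j
  have h3 := (twoOnes n hn).monotone_sizeUpTo (Fin.le_def.1 hle)
  -- Blocks after the first are singletons, so a position `j ≥ 2` is the first of its block and no
  -- smaller `i` shares it.
  have h4 : ∀ k, (twoOnes n hn).sizeUpTo (k + 1) = 2 + min k (n - 2) := by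
    intro k
    simp [Composition.sizeUpTo, twoOnes, List.take_replicate]
  have h5 := Fin.lt_def.1 hij
  rcases hk : ((twoOnes n hn).index j : ℕ) with _ | k
  · rw [hk, h4] at h2
    omega
  · rw [hk, h4] at h2 h3
    omega

theorem twoOnes_BLTA_le {n : ℕ} (S : Composition (n + 2)) (hS : 1 < S.blocks.headD 0) :
    BLTA (twoOnes (n + 2) (by omega)) ≤ BLTA S := by
  rintro π ⟨A, b, hA, h0, hπ⟩
  refine ⟨A, b, hA, fun i j hij => h0 i j ?_, hπ⟩
  have hlt : i < j := by
    by_contra h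
    exact absurd (index_mono S (not_lt.1 h)) (not_le.2 hij)
  refine twoOnes_index_lt _ hlt ?_
  by_contra hj
  have h1 : j = 1 := Fin.ext (by have := Fin.lt_def.1 hlt; rw [Fin.val_one]; omega)
  have h2 : i = 0 := Fin.ext (by
    have := Fin.lt_def.1 hlt; rw [h1, Fin.val_one] at this; rw [Fin.val_zero]; omega)
  rw [h1, h2, index_zero_eq_index_one S hS] at hij
  exact lt_irrefl _ hij

/-- The exchange of the two least significant bits. -/
def swapBits (n : ℕ) : Equiv.Perm (Idx (n + 2)) :=
  Equiv.arrowCongr (Equiv.swap 0 1) (Equiv.refl _)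

theorem swapBits_apply {n : ℕ} (z : Idx (n + 2)) : swapBits n z = z ∘ Equiv.swap 0 1 := rfl

theorem swapBits_mem_BLTA {n : ℕ} (S : Composition (n + 2)) (hS : 1 < S.blocks.headD 0) :
    swapBits n ∈ BLTA S := by
  have h : IsAffineMap (swapBits n)
      ((1 : Matrix (Fin (n + 2)) (Fin (n + 2)) (ZMod 2)).submatrix (Equiv.swap 0 1) id) 0 := by
    intro z
    funext k
    simp [swapBits_apply, Matrix.mulVec, dotProduct, Matrix.one_apply]
  refine ⟨_, _, h.isUnit, fun i j hij => ?_, h⟩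
  refine Matrix.one_apply_ne fun e => ?_
  have hs : ∀ k, S.index (Equiv.swap 0 1 k) = S.index k := by
    intro k
    by_cases h0 : k = 0
    · subst h0; rw [Equiv.swap_apply_left, index_zero_eq_index_one S hS]
    · by_cases h1 : k = 1
      · subst h1; rw [Equiv.swap_apply_right, index_zero_eq_index_one S hS]
      · rw [Equiv.swap_apply_of_ne_of_ne h0 h1]
  have : S.index i = S.index j := by rw [← hs i, e]; rfl
  exact absurd hij (this ▸ lt_irrefl _)

theorem permute_swapBits_transform {n : ℕ} (i : Idx (n + 2)) :
    permute (swapBits n) (transform (n + 2) i) = transform (n + 2) (i ∘ Equiv.swap 0 1) := by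
  funext z
  simp only [permute, swapBits_apply, transform]
  rw [← Equiv.prod_comp (Equiv.swap 0 1)]
  simp

/-- Setting a bit to `1` removes a variable (a factor), and `shift` lowers one variable (an
antecedent). Exchanging the two lowest bits permutes the rows, so its being an automorphism makes
`I` itself invariant. -/
theorem isStable_of_isDecreasing {n : ℕ} {I : Set (Idx (n + 2))}
    (h : IsDecreasing (generatingMonomials I)) (hs : swapBits n ∈ affineAut I) : IsStable I where
  up _ hi k := h.update_one_mem hi k
  shift _ hi _ _ hlk hk hl := h.shift_mem hi hlk hk hl
  swap i hi := by
    have := hs.2 _ (transform_mem_polarCode hi)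
    rw [permute_swapBits_transform] at this
    exact mem_of_transform_mem_polarCode this

/-! ### Ties form a null set -/

/-- The linear map that selects, for every index `z` of a half, one of the two positions above `z`
and a sign. -/
def leftSelect {n : ℕ} (s e : Word n) : Signal (n + 1) →ₗ[ℝ] Signal n where
  toFun y := flip e fun z => y (Fin.snoc z (s z))
  map_add' x y := by
    funext z
    rcases zmod_two_cases (e z) with h | h <;> simp [flip, h, add_comm]
  map_smul' a y := by
    funext z
    rcases zmod_two_cases (e z) with h | h <;> simp [flip, h]

/-- The log-likelihood ratios of the second half are linear for a fixed decision on the first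
half. -/
def rightSelect {n : ℕ} (x : Word n) : Signal (n + 1) →ₗ[ℝ] Signal n where
  toFun y := rightLLR x y
  map_add' y y' := by
    funext z
    rcases zmod_two_cases (x z) with h | h <;> simp [rightLLR, varNode, h] <;> ring
  map_smul' a y := by
    funext z
    rcases zmod_two_cases (x z) with h | h <;> simp [rightLLR, varNode, h] <;> ring

theorem leftSelect_surjective {n : ℕ} (s e : Word n) : Function.Surjective (leftSelect s e) := by
  intro v
  refine ⟨fun w => flip e v (Fin.init w), ?_⟩
  funext z
  rcases zmod_two_cases (e z) with h | h <;> simp [leftSelect, flip, h]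

theorem rightSelect_surjective {n : ℕ} (x : Word n) : Function.Surjective (rightSelect x) := by
  intro v
  refine ⟨fun w => if w (Fin.last n) = 0 then 0 else v (Fin.init w), ?_⟩
  funext z
  rcases zmod_two_cases (x z) with h | h <;> simp [rightSelect, rightLLR, varNode, h]

theorem checkNode_mem (a b : ℝ) :
    checkNode a b = a ∨ checkNode a b = -a ∨ checkNode a b = b ∨ checkNode a b = -b := by
  rcases eq_or_ne a 0 with ha | ha
  · exact Or.inl (by simp [checkNode, ha])
  rcases eq_or_ne b 0 with hb | hb
  · exact Or.inr (Or.inr (Or.inl (by simp [checkNode, hb])))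
  have hs : ∀ c : ℝ, c ≠ 0 → |Real.sign c| = 1 := fun c hc => by
    rcases Real.sign_apply_eq_of_ne_zero c hc with h | h <;> simp [h]
  have h : |checkNode a b| = min |a| |b| := by
    rw [checkNode, abs_mul, abs_mul, hs a ha, hs b hb, one_mul, one_mul,
      abs_of_nonneg (le_min (abs_nonneg a) (abs_nonneg b))]
  rcases min_choice |a| |b| with hm | hm <;> rw [hm, abs_eq_abs] at h <;> tauto

/-- A check node outputs one of its inputs up to sign, so `leftLLR` is piecewise linear with
finitely many pieces. -/
theorem exists_leftLLR_eq {n : ℕ} (y : Signal (n + 1)) :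
    ∃ s e : Word n, leftLLR y = leftSelect s e y := by
  have h : ∀ z : Idx n, ∃ p : ZMod 2 × ZMod 2, leftLLR y z =
      if p.2 = 0 then y (Fin.snoc z p.1) else - y (Fin.snoc z p.1) := by
    intro z
    rcases checkNode_mem (y (Fin.snoc z 0)) (y (Fin.snoc z 1)) with h | h | h | h
    · exact ⟨(0, 0), h.trans (by simp)⟩
    · exact ⟨(0, 1), h.trans (by simp)⟩
    · exact ⟨(1, 0), h.trans (by simp)⟩
    · exact ⟨(1, 1), h.trans (by simp)⟩
  choose p hp using h
  exact ⟨fun z => (p z).1, fun z => (p z).2, funext hp⟩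

/-- The selections and the decided word depend on `y` but range over finite sets, so all choices are
included. Composition with a surjective map keeps each functional nonzero. -/
theorem exists_tieFree_functionals {n : ℕ} (I : Set (Idx n)) :
    ∃ F : Set (Signal n →ₗ[ℝ] ℝ), F.Finite ∧ (∀ l ∈ F, l ≠ 0) ∧
      ∀ y, (∀ l ∈ F, l y ≠ 0) → TieFree n I y := by
  induction n with
  | zero =>
    refine ⟨Set.range fun z => LinearMap.proj z, Set.finite_range _, ?_, ?_⟩
    · rintro _ ⟨z, rfl⟩ h
      simpa using LinearMap.congr_fun h fun _ => (1 : ℝ)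
    · exact fun y hy z _ => hy _ ⟨z, rfl⟩
  | succ n ih =>
    obtain ⟨F, hF, hF0, hFt⟩ := ih (half 0 I)
    obtain ⟨G, hG, hG0, hGt⟩ := ih (half 1 I)
    refine ⟨(⋃ p : Word n × Word n, (fun l => l ∘ₗ leftSelect p.1 p.2) '' F) ∪
      ⋃ x : Word n, (fun l => l ∘ₗ rightSelect x) '' G, ?_, ?_, ?_⟩
    · exact (Set.finite_iUnion fun _ => hF.image _).union (Set.finite_iUnion fun _ => hG.image _)
    · intro l hl
      rcases hl with hl | hl
      · obtain ⟨p, l, hlF, rfl⟩ := Set.mem_iUnion.1 hl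
        intro h
        refine hF0 l hlF (LinearMap.ext fun v => ?_)
        obtain ⟨y, rfl⟩ := leftSelect_surjective p.1 p.2 v
        exact LinearMap.congr_fun h y
      · obtain ⟨x, l, hlG, rfl⟩ := Set.mem_iUnion.1 hl
        intro h
        refine hG0 l hlG (LinearMap.ext fun v => ?_)
        obtain ⟨y, rfl⟩ := rightSelect_surjective x v
        exact LinearMap.congr_fun h y
    · intro y hy
      refine ⟨hFt _ fun l hl => ?_, hGt _ fun l hl => ?_⟩
      · obtain ⟨s, e, h⟩ := exists_leftLLR_eq y
        rw [h]
        exact hy _ (Or.inl (Set.mem_iUnion.2 ⟨(s, e), l, hl, rfl⟩))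
      · exact hy _ (Or.inr (Set.mem_iUnion.2 ⟨_, l, hl, rfl⟩))

theorem ae_tieFree {n : ℕ} (I : Set (Idx n)) : ∀ᵐ y : Signal n, TieFree n I y := by
  obtain ⟨F, hF, hF0, hFt⟩ := exists_tieFree_functionals I
  have h : ∀ᵐ y : Signal n, ∀ l ∈ F, l y ≠ 0 := by
    refine (ae_ball_iff hF.countable).2 fun l hl => ?_
    have := Measure.addHaar_submodule (volume : Measure (Signal n)) (LinearMap.ker l)
      fun h => hF0 l hl (LinearMap.ker_eq_top.1 h)
    rw [ae_iff]
    simp only [not_not]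
    exact this
  exact h.mono hFt

end PolarSC
end

theorem theorem1 (n : ℕ) (hn : 2 ≤ n) (I : Set (PolarSC.Idx n))
    (hdec : PolarSC.IsDecreasing (PolarSC.generatingMonomials I))
    (S : Composition n) (hS : 1 < S.blocks.headD 0)
    (hA : PolarSC.affineAut I = PolarSC.BLTA S) :
    PolarSC.BLTA (PolarSC.twoOnes n hn) ≤
        PolarSC.absorbed (PolarSC.affineAut I) (PolarSC.sc n I) ∧
      ∀ π ∈ PolarSC.BLTA (PolarSC.twoOnes n hn), ∀ y : PolarSC.Signal n,
        PolarSC.TieFree n I y → PolarSC.autDec (PolarSC.sc n I) y π = PolarSC.sc n I y := by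
  obtain ⟨m, rfl⟩ := Nat.exists_eq_add_of_le' hn
  have hI : PolarSC.IsStable I :=
    PolarSC.isStable_of_isDecreasing hdec (hA ▸ PolarSC.swapBits_mem_BLTA S hS)
  have key : ∀ π ∈ PolarSC.BLTA (PolarSC.twoOnes (m + 2) hn), ∀ y : PolarSC.Signal (m + 2),
      PolarSC.TieFree (m + 2) I y →
        PolarSC.autDec (PolarSC.sc (m + 2) I) y π = PolarSC.sc (m + 2) I y := by
    rintro π ⟨A, b, -, h0, hπ⟩ y hy
    have h := hI.sc_permute hπ (fun i j hij hj => h0 i j (PolarSC.twoOnes_index_lt hn hij hj)) hy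
    rw [PolarSC.autDec, h]
    funext z
    simp [PolarSC.permute]
  refine ⟨fun π hπ => ⟨hA ▸ PolarSC.twoOnes_BLTA_le S hS hπ, ?_⟩, key⟩
  filter_upwards [PolarSC.ae_tieFree I] with y hy
  rw [key π hπ y hy]
  rfl
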